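/- For $n\ge 1$, a type $B_n$ set partition is a partition $\pi$ of the set $\{1,2,\ldots,n,-1,-2,\ldots,-n\}$ into non-empty blocks such that for every block $B$ of $\pi$ the set $-B=\{-b: b\in B\}$ is also a block of $\pi$, and such that there is at most one block $B$ with $B=-B$ (called the zero-block). If a block $B$ is not a zero-block, the unordered pair formed by $B$ and $-B$ is called a block pair of $\pi$. Let $\xi_n$ be the number of block pairs in a type $B_n$ set partition chosen uniformly at random. Then, as $n\to\infty$, the random variable \[ \frac{\xi_n-\mathbb{E}(\xi_n)}{\sqrt{\mathbb{V}(\xi_n)}} \] converges in distribution to the standard normal law. -/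

import Mathlib

open MeasureTheory ProbabilityTheory Filter
open scoped Pointwise

namespace TypeB

/-- The ground set `{1, 2, …, n, -1, -2, …, -n}`. -/
noncomputable def groundSet (n : ℕ) : Finset ℤ := (Finset.Icc (-(n : ℤ)) (n : ℤ)).erase 0

/-- A set partition of `{±1, …, ±n}` is of type `B_n` if the negative `-B = {-b : b ∈ B}` of every
block `B` is again a block, and there is at most one block with `-B = B`
(the zero-block). -/
def IsTypeB {n : ℕ} (π : Finpartition (groundSet n)) : Prop :=
  (∀ B ∈ π.parts, -B ∈ π.parts) ∧
    ∀ B ∈ π.parts, ∀ C ∈ π.parts, -B = B → -C = C → B = C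

/-- The type of `B_n`-partitions. -/
def BPartition (n : ℕ) : Type := {π : Finpartition (groundSet n) // IsTypeB π}

instance (n : ℕ) : Finite (BPartition n) :=
  inferInstanceAs (Finite {π : Finpartition (groundSet n) // IsTypeB π})

/-- The partition into singletons is of type `B_n` (without a zero-block). -/
instance (n : ℕ) : Nonempty (BPartition n) := by
  refine ⟨⟨⊥, ?_, ?_⟩⟩
  · intro B hB
    rw [Finpartition.mem_bot_iff] at hB ⊢
    obtain ⟨a, ha, rfl⟩ := hB
    refine ⟨-a, ?_, by simp⟩
    simp only [groundSet, Finset.mem_erase, Finset.mem_Icc] at ha ⊢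
    omega
  · intro B hB C _ hBB _
    rw [Finpartition.mem_bot_iff] at hB
    obtain ⟨a, ha, rfl⟩ := hB
    simp only [groundSet, Finset.mem_erase, Finset.mem_Icc] at ha
    rw [Finset.neg_singleton, Finset.singleton_inj] at hBB
    omega

/-- Every set of `B_n`-partitions is an event. -/
instance (n : ℕ) : MeasurableSpace (BPartition n) := ⊤

instance (n : ℕ) : DiscreteMeasurableSpace (BPartition n) := ⟨fun _ => trivial⟩

/-- The set of block pairs of `π`: the unordered pairs `{B, -B}`, where `B` runs over the blocks
that are not a zero-block. -/
def blockPairs {n : ℕ} (π : BPartition n) : Finset (Sym2 (Finset ℤ)) :=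
  (π.1.parts.filter fun B => -B ≠ B).image fun B => s(B, -B)

/-- The random variable `ξ_n`: the number of block pairs of a `B_n`-partition. -/
def xi (n : ℕ) (π : BPartition n) : ℝ := ((blockPairs π).card : ℝ)

/-- The uniform probability measure on the finite set of `B_n`-partitions. -/
noncomputable def unif (n : ℕ) : Measure (BPartition n) := uniformOn Set.univ

instance (n : ℕ) : IsProbabilityMeasure (unif n) :=
  isProbabilityMeasure_uniformOn Set.finite_univ Set.univ_nonempty

end TypeB

namespace TypeB

/-! Let `P n` be the polynomial counting partitions by their number of block pairs. Removing `±(n +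
1)` gives `P (n + 1) = (1 + X) P n + 2 X (P n)'` (`blockPoly_succ`). Up to a nonvanishing factor on
`y < 0`, the right side is the derivative of `√(-y) * exp (y / 2) * P n y`, so Rolle's theorem shows
inductively that all roots of `P n` are real and negative (`splits_blockPoly`). Hence `P n / P n 1`
is a product of generating polynomials of Bernoulli variables, and `ξ_n` is distributed as a sum of
independent Bernoulli variables. For such sums the distance from the Gaussian characteristic
function is controlled by the variance alone, so by Lévy's continuity theorem it remains to show
that the variance tends to infinity.

For this no asymptotics of the mean are needed. By Dobiński's formula the weights `(2j + 1)^n / (2^j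
j!)` have total `P n 1 * exp (1 / 2)`. Under the normalised weights, `2j + 1` has variance `4 V +
2`, where `V` is the variance of `ξ_n` (`hasSum_sq_sub_mul_dobinskiWeight`). The weights are nearly
flat just to the right of their mode, over any fixed number of indices once `n` is large. So no
single weight carries a fixed share of the mass, no window of fixed length captures half of it, and
`V` is unbounded (`tendsto_varBlocks`). -/

theorem mem_groundSet {n : ℕ} {x : ℤ} : x ∈ groundSet n ↔ x ≠ 0 ∧ |x| ≤ n := by
  simp [groundSet, abs_le]

theorem neg_mem_groundSet {n : ℕ} {x : ℤ} : -x ∈ groundSet n ↔ x ∈ groundSet n := by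
  simp [mem_groundSet]

/-! ### Canonical labellings of type `B_n` partitions -/

/-- The odd idempotent functions `f` on `ℤ` with `|f x| ≤ |x|`, supported in `[-n, n]`. They are the
canonical labellings of the blocks of `B_n`-partitions: the zero-block is labelled by `0` and any
other block by its element of least absolute value. -/
structure IsLabelling (n : ℕ) (f : ℤ → ℤ) : Prop where
  map_neg : ∀ x, f (-x) = -f x
  abs_le : ∀ x, |f x| ≤ |x|
  idem : ∀ x, f (f x) = f x
  support : ∀ x, (n : ℤ) < |x| → f x = 0

namespace IsLabelling

variable {n : ℕ} {f g : ℤ → ℤ}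

theorem map_zero (hf : IsLabelling n f) : f 0 = 0 := by
  have := hf.abs_le 0
  simpa using this

theorem abs_le_natCast (hf : IsLabelling n f) (x : ℤ) : |f x| ≤ n := by
  by_cases h : (n : ℤ) < |x|
  · simp [hf.support x h]
  · exact (hf.abs_le x).trans (not_lt.1 h)

theorem map_mem_groundSet (hf : IsLabelling n f) {x : ℤ} (h : f x ≠ 0) : f x ∈ groundSet n :=
  mem_groundSet.2 ⟨h, hf.abs_le_natCast x⟩

/-- A labelling is determined by its kernel. -/
theorem eq_of_ker_eq (hf : IsLabelling n f) (hg : IsLabelling n g)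
    (h : ∀ x ∈ groundSet n, ∀ y ∈ groundSet n, f x = f y ↔ g x = g y) : f = g := by
  -- By oddness the label `0` is visible in the kernel: `f x = 0` exactly when `f x = f (-x)`.
  have key : ∀ {f g : ℤ → ℤ}, IsLabelling n f → IsLabelling n g →
      (∀ x ∈ groundSet n, ∀ y ∈ groundSet n, f x = f y ↔ g x = g y) →
      ∀ x ∈ groundSet n, f x = 0 → g x = 0 := by
    intro f g hf hg h x hx h0
    have := (h x hx (-x) (neg_mem_groundSet.2 hx)).1 (by rw [hf.map_neg, h0, neg_zero])
    rw [hg.map_neg] at this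
    omega
  have key2 : ∀ {f g : ℤ → ℤ}, IsLabelling n f → IsLabelling n g →
      (∀ x ∈ groundSet n, ∀ y ∈ groundSet n, f x = f y ↔ g x = g y) →
      ∀ x ∈ groundSet n, f x ≠ 0 → g (f x) = g x := fun {f g} hf hg h x hx h0 =>
    (h _ (hf.map_mem_groundSet h0) x hx).1 (hf.idem x)
  have h' : ∀ x ∈ groundSet n, ∀ y ∈ groundSet n, g x = g y ↔ f x = f y :=
    fun x hx y hy => (h x hx y hy).symm
  funext x
  by_cases hx : x ∈ groundSet n
  · by_cases hfx : f x = 0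
    · rw [hfx, key hf hg h x hx hfx]
    · have hgx : g x ≠ 0 := fun h0 => hfx (key hg hf h' x hx h0)
      have e1 := key2 hf hg h x hx hfx
      have e2 := key2 hg hf h' x hx hgx
      have a1 := hg.abs_le (f x)
      have a2 := hf.abs_le (g x)
      rw [e1] at a1
      rw [e2] at a2
      -- Each label lies in the block of the other, so minimality makes their absolute values equal.
      -- Opposite signs would put `g x` and `-g x` in one block, which would force `g x = 0`.
      rcases abs_eq_abs.1 (le_antisymm a2 a1) with e | e
      · exact e
      · exfalso
        rw [e, hg.map_neg, hg.idem] at e1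
        omega
  · rw [mem_groundSet, not_and_or, not_not, not_le] at hx
    rcases hx with rfl | hx
    · rw [hf.map_zero, hg.map_zero]
    · rw [hf.support x hx, hg.support x hx]

end IsLabelling

/-- The partition of the ground set into the fibres of `f`. -/
noncomputable def fiberPartition (n : ℕ) (f : ℤ → ℤ) : Finpartition (groundSet n) :=
  Finpartition.ofExistsUnique
    ((groundSet n).image fun x => (groundSet n).filter fun y => f y = f x)
    (by
      intro p hp
      obtain ⟨x, -, rfl⟩ := Finset.mem_image.1 hp
      exact Finset.filter_subset _ _)
    (by
      intro a ha
      refine ⟨(groundSet n).filter fun y => f y = f a,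
        ⟨Finset.mem_image_of_mem _ ha, by simp [ha]⟩, ?_⟩
      rintro t ⟨ht, hat⟩
      obtain ⟨x, -, rfl⟩ := Finset.mem_image.1 ht
      rw [(Finset.mem_filter.1 hat).2])
    (by
      intro h
      obtain ⟨x, hx, h0⟩ := Finset.mem_image.1 h
      have : x ∈ (∅ : Finset ℤ) := h0 ▸ by simp [hx]
      simp at this)

theorem mem_fiberPartition_parts {n : ℕ} {f : ℤ → ℤ} {B : Finset ℤ} :
    B ∈ (fiberPartition n f).parts ↔
      ∃ x ∈ groundSet n, ((groundSet n).filter fun y => f y = f x) = B :=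
  Finset.mem_image

theorem neg_filter_groundSet {n : ℕ} {f : ℤ → ℤ} (hf : ∀ x, f (-x) = -f x) (a : ℤ) :
    -((groundSet n).filter fun y => f y = a) = (groundSet n).filter fun y => f y = -a := by
  ext y
  rw [Finset.mem_neg', Finset.mem_filter, Finset.mem_filter, neg_mem_groundSet, hf, neg_eq_iff_eq_neg]

theorem filter_groundSet_inj {n : ℕ} {f : ℤ → ℤ} {x : ℤ} {a : ℤ} (hx : x ∈ groundSet n)
    (h : ((groundSet n).filter fun y => f y = f x) = (groundSet n).filter fun y => f y = a) :
    f x = a := by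
  have : x ∈ (groundSet n).filter fun y => f y = f x := by simp [hx]
  rw [h] at this
  exact (Finset.mem_filter.1 this).2

theorem isTypeB_fiberPartition {n : ℕ} {f : ℤ → ℤ} (hf : ∀ x, f (-x) = -f x) :
    IsTypeB (fiberPartition n f) := by
  constructor
  · intro B hB
    obtain ⟨x, hx, rfl⟩ := mem_fiberPartition_parts.1 hB
    rw [neg_filter_groundSet hf]
    exact mem_fiberPartition_parts.2 ⟨-x, neg_mem_groundSet.2 hx, by rw [hf]⟩
  · intro B hB C hC hBB hCC
    obtain ⟨x, hx, rfl⟩ := mem_fiberPartition_parts.1 hB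
    obtain ⟨y, hy, rfl⟩ := mem_fiberPartition_parts.1 hC
    rw [neg_filter_groundSet hf] at hBB hCC
    have h1 := filter_groundSet_inj hx hBB.symm
    have h2 := filter_groundSet_inj hy hCC.symm
    have : f x = f y := by omega
    rw [this]

/-- The number of non-zero labels, up to sign. -/
noncomputable def labelCount (n : ℕ) (f : ℤ → ℤ) : ℕ := ((Finset.Icc (1 : ℤ) n).filter fun m => f m = m).card

/-- The `B_n`-partition with a given labelling. -/
noncomputable def ofLabelling {n : ℕ} (f : {f // IsLabelling n f}) : BPartition n :=
  ⟨fiberPartition n f.1, isTypeB_fiberPartition f.2.map_neg⟩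

/-- Of the two opposite labels of a block pair exactly one is positive, so the positive fixed points
of `f` enumerate the block pairs. -/
theorem card_blockPairs_ofLabelling {n : ℕ} {f : ℤ → ℤ} (hf : IsLabelling n f) :
    (blockPairs (ofLabelling ⟨f, hf⟩)).card = labelCount n f := by
  symm
  refine Finset.card_bij (fun m _ => s((groundSet n).filter fun y => f y = m,
    -(groundSet n).filter fun y => f y = m)) ?_ ?_ ?_
  · intro m hm
    obtain ⟨hm, hfm⟩ := Finset.mem_filter.1 hm
    rw [Finset.mem_Icc] at hm
    have hmg : m ∈ groundSet n := mem_groundSet.2 ⟨by omega, by rw [abs_le]; omega⟩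
    have hB : ((groundSet n).filter fun y => f y = m) ∈ (fiberPartition n f).parts :=
      mem_fiberPartition_parts.2 ⟨m, hmg, by rw [hfm]⟩
    refine Finset.mem_image.2 ⟨_, Finset.mem_filter.2 ⟨hB, fun h => ?_⟩, rfl⟩
    rw [neg_filter_groundSet hf.map_neg] at h
    have := filter_groundSet_inj (f := f) (a := -m) hmg (by rw [hfm]; exact h.symm)
    omega
  · intro m hm m' hm' h
    obtain ⟨hm, hfm⟩ := Finset.mem_filter.1 hm
    rw [Finset.mem_Icc] at hm
    obtain ⟨hm', hfm'⟩ := Finset.mem_filter.1 hm'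
    rw [Finset.mem_Icc] at hm'
    have hmg : m ∈ groundSet n := mem_groundSet.2 ⟨by omega, by rw [abs_le]; omega⟩
    simp only [neg_filter_groundSet hf.map_neg] at h
    rcases Sym2.eq_iff.1 h with h | h
    · have := filter_groundSet_inj (f := f) (a := m') hmg (by rw [hfm]; exact h.1)
      omega
    · have := filter_groundSet_inj (f := f) (a := -m') hmg (by rw [hfm]; exact h.1)
      omega
  · intro b hb
    obtain ⟨B, hB, rfl⟩ := Finset.mem_image.1 hb
    obtain ⟨hB, hBB⟩ := Finset.mem_filter.1 hB
    obtain ⟨x, hx, rfl⟩ := mem_fiberPartition_parts.1 hB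
    dsimp only at hBB ⊢
    have h0 : f x ≠ 0 := by
      intro h0
      apply hBB
      rw [neg_filter_groundSet hf.map_neg]
      simp only [h0, neg_zero]
    have hle := hf.abs_le_natCast x
    have hid := hf.idem x
    rcases lt_or_gt_of_ne h0 with h | h
    · rw [abs_of_neg h] at hle
      refine ⟨-f x, Finset.mem_filter.2 ⟨Finset.mem_Icc.2 ⟨by omega, hle⟩, ?_⟩, ?_⟩
      · rw [hf.map_neg, hid]
      · rw [← neg_filter_groundSet hf.map_neg, neg_neg, Sym2.eq_swap]
    · rw [abs_of_pos h] at hle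
      exact ⟨f x, Finset.mem_filter.2 ⟨Finset.mem_Icc.2 ⟨by omega, hle⟩, hid⟩, rfl⟩

theorem ofLabelling_injective (n : ℕ) : Function.Injective (ofLabelling (n := n)) := by
  have key : ∀ f g : ℤ → ℤ, (fiberPartition n f) = (fiberPartition n g) →
      ∀ x ∈ groundSet n, ∀ y ∈ groundSet n, f x = f y → g x = g y := by
    intro f g h x hx y hy hxy
    have hB : ((groundSet n).filter fun y => f y = f x) ∈ (fiberPartition n g).parts :=
      h ▸ mem_fiberPartition_parts.2 ⟨x, hx, rfl⟩
    obtain ⟨z, hz, e⟩ := mem_fiberPartition_parts.1 hB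
    have h1 : x ∈ (groundSet n).filter fun y => f y = f x := by simp [hx]
    have h2 : y ∈ (groundSet n).filter fun y => f y = f x := by simp [hy, hxy]
    rw [← e, Finset.mem_filter] at h1 h2
    rw [h1.2, h2.2]
  rintro ⟨f, hf⟩ ⟨g, hg⟩ h
  have h' : fiberPartition n f = fiberPartition n g := congrArg Subtype.val h
  exact Subtype.ext (hf.eq_of_ker_eq hg fun x hx y hy =>
    ⟨key f g h' x hx y hy, key g f h'.symm x hx y hy⟩)

theorem IsTypeB.part_neg {n : ℕ} {π : Finpartition (groundSet n)} (hπ : IsTypeB π) (x : ℤ) :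
    π.part (-x) = -π.part x := by
  by_cases hx : x ∈ groundSet n
  · refine π.part_eq_of_mem (hπ.1 _ (π.part_mem.2 hx)) ?_
    rw [Finset.mem_neg', neg_neg]
    exact π.mem_part hx
  · rw [π.part_eq_empty.2 hx, π.part_eq_empty.2 (by rwa [neg_mem_groundSet])]
    rfl

/-- A block that is not a zero-block is disjoint from its negative, so it has a unique element of
least absolute value, which serves as its label. Uniqueness of the zero-block is what makes the
fibre over `0` a single block. -/
theorem ofLabelling_surjective (n : ℕ) : Function.Surjective (ofLabelling (n := n)) := by
  classical
  rintro ⟨π, hπ⟩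
  -- The clause `-m ∉ π.part x` makes the minimiser unique and leaves the zero-block without a
  -- label; the default `0` is then used, as it is outside the ground set, where `π.part` is empty.
  let L : ℤ → ℤ → Prop := fun x m =>
    m ∈ π.part x ∧ -m ∉ π.part x ∧ ∀ y ∈ π.part x, |m| ≤ |y|
  have L_unique : ∀ x m m', L x m → L x m' → m = m' := by
    rintro x m m' ⟨h1, h2, h3⟩ ⟨h1', h2', h3'⟩
    rcases abs_eq_abs.1 (le_antisymm (h3 _ h1') (h3' _ h1)) with h | h
    · exact h
    · exact absurd (h ▸ h1) h2'
  have L_neg : ∀ x m, L x m → L (-x) (-m) := by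
    rintro x m ⟨h1, h2, h3⟩
    refine ⟨?_, ?_, ?_⟩
    · rw [hπ.part_neg, Finset.mem_neg', neg_neg]; exact h1
    · rw [hπ.part_neg, Finset.mem_neg', neg_neg]; exact h2
    · intro y hy
      rw [hπ.part_neg, Finset.mem_neg'] at hy
      simpa using h3 _ hy
  have part_eq : ∀ {x y}, y ∈ π.part x → π.part y = π.part x := by
    intro x y h
    have hx : x ∈ groundSet n := by
      by_contra hx
      rw [π.part_eq_empty.2 hx] at h
      simp at h
    exact π.part_eq_of_mem (π.part_mem.2 hx) h
  have L_self : ∀ x m, L x m → L m m := by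
    intro x m h
    have := part_eq h.1
    simp only [L, this]
    exact h
  have L_exists : ∀ x ∈ groundSet n, -π.part x ≠ π.part x → ∃ m, L x m := by
    intro x hx h
    obtain ⟨m, hm, hmin⟩ := Finset.exists_min_image (π.part x) (fun y => |y|) ⟨x, π.mem_part hx⟩
    refine ⟨m, hm, fun hneg => h ?_, hmin⟩
    calc -π.part x = π.part (-m) := by rw [hπ.part_neg, part_eq hm]
      _ = π.part x := part_eq hneg
  let f : ℤ → ℤ := fun x => if h : ∃ m, L x m then h.choose else 0
  have f_of : ∀ x m, L x m → f x = m := by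
    intro x m h
    have hex : ∃ m, L x m := ⟨m, h⟩
    simp only [f, dif_pos hex]
    exact L_unique _ _ _ hex.choose_spec h
  have f_cases : ∀ x, L x (f x) ∨ ((¬ ∃ m, L x m) ∧ f x = 0) := by
    intro x
    by_cases hex : ∃ m, L x m
    · left
      simp only [f, dif_pos hex]
      exact hex.choose_spec
    · exact Or.inr ⟨hex, dif_neg hex⟩
  have hL0 : ∀ x, ¬ L x 0 := fun x h => h.2.1 (by simpa using h.1)
  have hf : IsLabelling n f := by
    refine ⟨?_, ?_, ?_, ?_⟩
    · intro x
      rcases f_cases x with h | ⟨h, h0⟩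
      · exact f_of _ _ (L_neg _ _ h)
      · rw [h0, neg_zero]
        refine dif_neg ?_
        rintro ⟨m, hm⟩
        exact h ⟨-m, by simpa using L_neg _ _ hm⟩
    · intro x
      rcases f_cases x with h | ⟨h, h0⟩
      · by_cases hx : x ∈ groundSet n
        · exact h.2.2 x (π.mem_part hx)
        · have := h.1
          rw [π.part_eq_empty.2 hx] at this
          simp at this
      · simp [h0]
    · intro x
      rcases f_cases x with h | ⟨h, h0⟩
      · exact f_of _ _ (L_self _ _ h)
      · rw [h0]
        rcases f_cases 0 with h' | ⟨-, h'⟩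
        · have := h'.1
          rw [π.part_eq_empty.2 (by simp [mem_groundSet])] at this
          simp at this
        · exact h'
    · intro x hx
      refine dif_neg ?_
      rintro ⟨m, hm⟩
      have := hm.1
      rw [π.part_eq_empty.2 (by rw [mem_groundSet]; omega)] at this
      simp at this
  have ker : ∀ x ∈ groundSet n, ∀ y ∈ groundSet n, f y = f x ↔ y ∈ π.part x := by
    intro x hx y hy
    constructor
    · intro h
      rcases f_cases x with h1 | ⟨h1, h10⟩
      · rcases f_cases y with h2 | ⟨h2, h20⟩
        · rw [h] at h2
          rw [← part_eq h1.1, part_eq h2.1]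
          exact π.mem_part hy
        · rw [← h, h20] at h1
          exact absurd h1 (hL0 _)
      · rcases f_cases y with h2 | ⟨h2, h20⟩
        · rw [h, h10] at h2
          exact absurd h2 (hL0 _)
        · have e1 : -π.part x = π.part x := by
            by_contra hne
            exact h1 (L_exists x hx hne)
          have e2 : -π.part y = π.part y := by
            by_contra hne
            exact h2 (L_exists y hy hne)
          rw [hπ.2 _ (π.part_mem.2 hx) _ (π.part_mem.2 hy) e1 e2]
          exact π.mem_part hy
    · intro h
      have : L y = L x := by
        funext m
        simp only [L, part_eq h]
      simp only [f, this]
  refine ⟨⟨f, hf⟩, Subtype.ext (Finpartition.ext ?_)⟩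
  have fiber_eq : ∀ x ∈ groundSet n, ((groundSet n).filter fun y => f y = f x) = π.part x := by
    intro x hx
    ext y
    rw [Finset.mem_filter]
    constructor
    · rintro ⟨hy, h⟩
      exact (ker x hx y hy).1 h
    · intro h
      have hy := π.part_subset x h
      exact ⟨hy, (ker x hx y hy).2 h⟩
  ext B
  change B ∈ (fiberPartition n f).parts ↔ _
  rw [mem_fiberPartition_parts]
  constructor
  · rintro ⟨x, hx, rfl⟩
    rw [fiber_eq x hx]
    exact π.part_mem.2 hx
  · intro hB
    obtain ⟨x, hxB⟩ := π.nonempty_of_mem_parts hB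
    have hx := π.subset hB hxB
    exact ⟨x, hx, by rw [fiber_eq x hx, π.part_eq_of_mem hB hxB]⟩

/-- Labellings of the blocks of `B_n`-partitions. -/
def Labelling (n : ℕ) : Type := {f : ℤ → ℤ // IsLabelling n f}

instance (n : ℕ) : Finite (Labelling n) := Finite.of_injective _ (ofLabelling_injective n)

noncomputable instance (n : ℕ) : Fintype (Labelling n) := Fintype.ofFinite _

noncomputable instance (n : ℕ) : Fintype (BPartition n) := Fintype.ofFinite _

/-! ### Adding the elements `±(n + 1)` to a labelling -/

/-- The labels, including `0`. -/
noncomputable def labels (n : ℕ) (f : ℤ → ℤ) : Finset ℤ :=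
  (Finset.Icc (-n : ℤ) n).filter fun m => f m = m

theorem card_labels {n : ℕ} {f : ℤ → ℤ} (hf : IsLabelling n f) :
    (labels n f).card = 2 * labelCount n f + 1 := by
  set T := (Finset.Icc (1 : ℤ) n).filter fun m => f m = m with hT
  have hmem : ∀ x, x ∈ T ↔ (1 ≤ x ∧ x ≤ n) ∧ f x = x := by simp [T]
  have h1 : labels n f = insert 0 (T ∪ -T) := by
    ext x
    have h2 := hf.map_neg x
    simp only [labels, Finset.mem_filter, Finset.mem_Icc, Finset.mem_insert, Finset.mem_union,
      Finset.mem_neg', hmem]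
    constructor
    · rintro ⟨⟨h3, h4⟩, h5⟩
      rcases lt_trichotomy x 0 with h | h | h
      · right; right; omega
      · left; exact h
      · right; left; omega
    · rintro (rfl | h | h)
      · exact ⟨by omega, hf.map_zero⟩
      · omega
      · omega
  have h2 : Disjoint T (-T) := by
    rw [Finset.disjoint_left]
    intro x hx hx'
    rw [Finset.mem_neg', hmem] at hx'
    rw [hmem] at hx
    omega
  have h3 : (0 : ℤ) ∉ T ∪ -T := by
    rw [Finset.mem_union, Finset.mem_neg', hmem, hmem]
    omega
  rw [h1, Finset.card_insert_of_notMem h3, Finset.card_union_of_disjoint h2, Finset.card_neg,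
    labelCount, ← hT]
  ring

/-- The possible labels of `n + 1` in a labelling extending `f`. -/
noncomputable def nextLabels (n : ℕ) (f : ℤ → ℤ) : Finset ℤ := insert (n + 1 : ℤ) (labels n f)

/-- The odd extension of `f` with value `v` at `n + 1`. -/
def extend (n : ℕ) (f : ℤ → ℤ) (v : ℤ) : ℤ → ℤ := fun x =>
  if x = n + 1 then v else if x = -(n + 1) then -v else f x

/-- The restriction of `f` to `[-n, n]`, extended by zero. -/
def restrict (n : ℕ) (f : ℤ → ℤ) : ℤ → ℤ := fun x => if |x| ≤ n then f x else 0

theorem mem_nextLabels {n : ℕ} {f : ℤ → ℤ} {v : ℤ} :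
    v ∈ nextLabels n f ↔ v = n + 1 ∨ |v| ≤ n ∧ f v = v := by
  simp [nextLabels, labels, abs_le]

theorem extend_of_abs_le {n : ℕ} {f : ℤ → ℤ} {v x : ℤ} (h : |x| ≤ n) : extend n f v x = f x := by
  rw [abs_le] at h
  simp only [extend]
  rw [if_neg (by omega), if_neg (by omega)]

@[simp] theorem extend_self {n : ℕ} {f : ℤ → ℤ} {v : ℤ} : extend n f v (n + 1) = v := by
  simp [extend]

@[simp] theorem extend_neg_self {n : ℕ} {f : ℤ → ℤ} {v : ℤ} : extend n f v (-(n + 1)) = -v := by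
  simp only [extend]
  rw [if_neg (by omega)]
  simp

theorem eq_or_abs_le_or_lt (n : ℕ) (x : ℤ) :
    x = n + 1 ∨ x = -(n + 1) ∨ |x| ≤ n ∨ (n + 1 : ℤ) < |x| := by
  rw [abs_le, lt_abs]
  omega

theorem extend_of_lt {n : ℕ} {f : ℤ → ℤ} (hf : IsLabelling n f) {v x : ℤ}
    (h : (n + 1 : ℤ) < |x|) : extend n f v x = 0 := by
  have h0 := hf.support x (by omega)
  rw [lt_abs] at h
  simp only [extend]
  rw [if_neg (by omega), if_neg (by omega), h0]

theorem isLabelling_extend {n : ℕ} {f : ℤ → ℤ} (hf : IsLabelling n f) {v : ℤ}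
    (hv : v ∈ nextLabels n f) : IsLabelling (n + 1) (extend n f v) := by
  have hvle : |v| ≤ n + 1 := by
    rcases mem_nextLabels.1 hv with rfl | ⟨h, -⟩
    · rw [abs_of_nonneg (by omega)]
    · omega
  have hvv : extend n f v v = v := by
    rcases mem_nextLabels.1 hv with rfl | ⟨h, h'⟩
    · exact extend_self
    · rw [extend_of_abs_le h, h']
  have hodd : ∀ x, extend n f v (-x) = -extend n f v x := by
    intro x
    rcases eq_or_abs_le_or_lt n x with rfl | rfl | h | h
    · rw [extend_neg_self, extend_self]
    · rw [neg_neg, extend_neg_self, extend_self, neg_neg]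
    · rw [extend_of_abs_le h, extend_of_abs_le (by rwa [abs_neg]), hf.map_neg]
    · rw [extend_of_lt hf h, extend_of_lt hf (by rwa [abs_neg]), neg_zero]
  refine ⟨hodd, ?_, ?_, ?_⟩
  · intro x
    rcases eq_or_abs_le_or_lt n x with rfl | rfl | h | h
    · rw [extend_self, abs_of_nonneg (a := (n + 1 : ℤ)) (by omega)]; exact hvle
    · rw [extend_neg_self, abs_neg, abs_neg, abs_of_nonneg (a := (n + 1 : ℤ)) (by omega)]
      exact hvle
    · rw [extend_of_abs_le h]; exact hf.abs_le x
    · rw [extend_of_lt hf h, abs_zero]; exact abs_nonneg x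
  · intro x
    rcases eq_or_abs_le_or_lt n x with rfl | rfl | h | h
    · rw [extend_self, hvv]
    · rw [extend_neg_self, hodd, hvv]
    · rw [extend_of_abs_le h, extend_of_abs_le (hf.abs_le_natCast x), hf.idem]
    · rw [extend_of_lt hf h, extend_of_abs_le (by simp), hf.map_zero]
  · intro x hx
    exact extend_of_lt hf (by exact_mod_cast hx)

theorem isLabelling_restrict {n : ℕ} {f : ℤ → ℤ} (hf : IsLabelling (n + 1) f) :
    IsLabelling n (restrict n f) := by
  have hin : ∀ {x : ℤ}, |x| ≤ n → restrict n f x = f x := fun h => if_pos h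
  have hout : ∀ {x : ℤ}, ¬ |x| ≤ n → restrict n f x = 0 := fun h => if_neg h
  refine ⟨?_, ?_, ?_, ?_⟩
  · intro x
    by_cases h : |x| ≤ n
    · rw [hin h, hin (by rwa [abs_neg]), hf.map_neg]
    · rw [hout h, hout (by rwa [abs_neg]), neg_zero]
  · intro x
    by_cases h : |x| ≤ n
    · rw [hin h]; exact hf.abs_le x
    · rw [hout h, abs_zero]; exact abs_nonneg x
  · intro x
    by_cases h : |x| ≤ n
    · rw [hin h, hin ((hf.abs_le x).trans h), hf.idem]
    · rw [hout h, hin (by simp), hf.map_zero]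
  · intro x hx
    exact hout (not_le.2 hx)

theorem map_mem_nextLabels {n : ℕ} {f : ℤ → ℤ} (hf : IsLabelling (n + 1) f) :
    f (n + 1) ∈ nextLabels n (restrict n f) := by
  rw [mem_nextLabels]
  have h := hf.abs_le_natCast (n + 1)
  rcases eq_or_abs_le_or_lt n (f (n + 1)) with h' | h' | h' | h'
  · exact Or.inl h'
  -- The value `-(n + 1)` is excluded: by oddness `f` would swap `±(n + 1)`, against idempotence.
  · have h1 := hf.idem (n + 1)
    rw [h', hf.map_neg, h'] at h1
    omega
  · refine Or.inr ⟨h', ?_⟩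
    rw [restrict, if_pos h', hf.idem]
  · push_cast at h
    omega

/-- A labelling on `n + 1` elements is a labelling on `n` elements with a choice of the label of
the new element. -/
noncomputable def labellingSuccEquiv (n : ℕ) :
    Labelling (n + 1) ≃ Σ f : Labelling n, {v // v ∈ nextLabels n f.1} where
  toFun f := ⟨⟨restrict n f.1, isLabelling_restrict f.2⟩, ⟨f.1 (n + 1), map_mem_nextLabels f.2⟩⟩
  invFun p := ⟨extend n p.1.1 p.2.1, isLabelling_extend p.1.2 p.2.2⟩
  left_inv := by
    rintro ⟨f, hf⟩
    refine Subtype.ext (funext fun x => ?_)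
    change extend n (restrict n f) (f (n + 1)) x = f x
    rcases eq_or_abs_le_or_lt n x with rfl | rfl | h | h
    · exact extend_self
    · rw [extend_neg_self, hf.map_neg]
    · rw [extend_of_abs_le h, restrict, if_pos h]
    · rw [extend_of_lt (isLabelling_restrict hf) h, hf.support x (by exact_mod_cast h)]
  right_inv := by
    rintro ⟨⟨f, hf⟩, ⟨v, hv⟩⟩
    have h : restrict n (extend n f v) = f := by
      funext x
      by_cases h : |x| ≤ n
      · rw [restrict, if_pos h, extend_of_abs_le h]
      · rw [restrict, if_neg h, hf.support x (not_le.1 h)]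
    refine Sigma.ext (Subtype.ext h) ?_
    refine (Subtype.heq_iff_coe_eq ?_).2 extend_self
    intro x
    change x ∈ nextLabels n (restrict n (extend n f v)) ↔ x ∈ nextLabels n f
    rw [h]

theorem labelCount_extend {n : ℕ} {f : ℤ → ℤ} {v : ℤ} :
    labelCount (n + 1) (extend n f v) = labelCount n f + if v = n + 1 then 1 else 0 := by
  have h : Finset.Icc (1 : ℤ) ((n + 1 : ℕ) : ℤ) =
      insert (n + 1 : ℤ) (Finset.Icc (1 : ℤ) n) := by
    ext x
    simp only [Finset.mem_insert, Finset.mem_Icc]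
    push_cast
    omega
  have h2 : ((Finset.Icc (1 : ℤ) n).filter fun m => extend n f v m = m) =
      (Finset.Icc (1 : ℤ) n).filter fun m => f m = m := by
    refine Finset.filter_congr fun x hx => ?_
    rw [Finset.mem_Icc] at hx
    rw [extend_of_abs_le (by rw [abs_le]; omega)]
  rw [labelCount, labelCount, h, Finset.filter_insert, extend_self, h2]
  split_ifs with hv
  · rw [Finset.card_insert_of_notMem (by simp)]
  · rfl

/-! ### The generating polynomial and its recurrence -/

open Polynomial

/-- The generating polynomial of the number of block pairs of `B_n`-partitions. -/
noncomputable def blockPoly (n : ℕ) : ℝ[X] := ∑ π : BPartition n, X ^ (blockPairs π).card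

theorem blockPoly_eq_sum_labelling (n : ℕ) :
    blockPoly n = ∑ f : Labelling n, X ^ labelCount n f.1 :=
  (Fintype.sum_bijective (fun f : Labelling n => (ofLabelling f : BPartition n))
    ⟨ofLabelling_injective n, ofLabelling_surjective n⟩
    (fun f => X ^ labelCount n f.1) (fun π => X ^ (blockPairs π).card)
    fun f => by rw [← card_blockPairs_ofLabelling f.2]; rfl).symm

theorem blockPoly_zero : blockPoly 0 = 1 := by
  have h : ∀ f : ℤ → ℤ, IsLabelling 0 f ↔ f = 0 := by
    intro f
    constructor
    · intro hf
      funext x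
      by_cases hx : x = 0
      · rw [hx, hf.map_zero]; rfl
      · exact hf.support x (by simpa using hx)
    · rintro rfl
      exact ⟨by simp, by simp, by simp, by simp⟩
  have : Unique (Labelling 0) :=
    { default := ⟨0, (h 0).2 rfl⟩
      uniq := fun f => Subtype.ext ((h _).1 f.2) }
  rw [blockPoly_eq_sum_labelling, Fintype.sum_unique]
  simp [labelCount]

/-- With `k` block pairs, `n + 1` can join any of the `2k` paired blocks or take the label `0`, or
it can start a new pair. So `X^k` becomes `(2k + 1) X^k + X^(k + 1)`, which is `(1 + X) X^k + 2 X
(X^k)'`. -/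
theorem blockPoly_succ (n : ℕ) :
    blockPoly (n + 1) = (1 + X) * blockPoly n + 2 * X * derivative (blockPoly n) := by
  have h1 : blockPoly (n + 1) = ∑ f : Labelling n, ∑ v ∈ nextLabels n f.1,
      X ^ (labelCount n f.1 + if v = n + 1 then 1 else 0) := by
    rw [blockPoly_eq_sum_labelling, ← (labellingSuccEquiv n).symm.sum_comp, Fintype.sum_sigma]
    refine Finset.sum_congr rfl fun f _ => ?_
    rw [← Finset.sum_coe_sort (nextLabels n f.1)]
    refine Finset.sum_congr rfl fun v _ => ?_
    rw [← labelCount_extend]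
    rfl
  rw [h1, blockPoly_eq_sum_labelling, derivative_sum, Finset.mul_sum, Finset.mul_sum,
    ← Finset.sum_add_distrib]
  refine Finset.sum_congr rfl fun f _ => ?_
  have hnot : (n + 1 : ℤ) ∉ labels n f.1 := by simp [labels]
  have hconst : ∀ v ∈ labels n f.1, (X : ℝ[X]) ^ (labelCount n f.1 + if v = n + 1 then 1 else 0) =
      X ^ labelCount n f.1 := by
    intro v hv
    rw [if_neg (fun h : v = n + 1 => hnot (h ▸ hv)), add_zero]
  rw [nextLabels, Finset.sum_insert hnot, Finset.sum_congr rfl hconst, Finset.sum_const,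
    card_labels f.2, if_pos rfl, derivative_X_pow, nsmul_eq_mul]
  rcases labelCount n f.1 with _ | k
  · simp
    ring
  · push_cast
    simp only [map_add, map_natCast, map_one]
    ring

/-! ### Real-rootedness and Bernoulli factors -/

/-- **Rolle's theorem** for `√(-y) * exp (y / 2) * p y` on the non-positive half-line. -/
theorem exists_eval_eq_zero_of_rolle (p : ℝ[X]) {x y : ℝ} (hxy : x < y) (hy : y ≤ 0)
    (hx0 : p.eval x = 0) (hy0 : y = 0 ∨ p.eval y = 0) :
    ∃ c, x < c ∧ c < y ∧ ((1 + X) * p + 2 * X * derivative p).eval c = 0 := by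
  -- For `u < 0`, `f' u = -exp (u / 2) / (2 √(-u)) * ((1 + u) p u + 2 u p' u)`. The square root
  -- supplies an extra zero at `0`; differentiability there is not needed.
  set f : ℝ → ℝ := fun u => √(-u) * Real.exp (u / 2) * p.eval u with hf
  have hcont : ContinuousOn f (Set.Icc x y) := by
    have := p.continuous
    exact Continuous.continuousOn (by fun_prop)
  have hfx : f x = 0 := by simp [hf, hx0]
  have hfy : f y = 0 := by
    rcases hy0 with rfl | h
    · simp [hf]
    · simp [hf, h]
  obtain ⟨c, hc, hd⟩ := exists_deriv_eq_zero hxy hcont (hfx.trans hfy.symm)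
  refine ⟨c, hc.1, hc.2, ?_⟩
  have hc0 : 0 < -c := by linarith [hc.2]
  have h1 : HasDerivAt (fun u : ℝ => √(-u)) (-1 / (2 * √(-c))) c :=
    (hasDerivAt_neg c).sqrt hc0.ne'
  have h2 : HasDerivAt (fun u : ℝ => Real.exp (u / 2)) (Real.exp (c / 2) * (1 / 2)) c :=
    ((hasDerivAt_id c).div_const 2).exp
  have h3 := (h1.mul h2).mul (p.hasDerivAt c)
  have h4 : deriv f c = _ := h3.deriv
  rw [h4] at hd
  simp only [Pi.mul_apply] at hd
  have hs : 0 < √(-c) := Real.sqrt_pos.2 hc0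
  have hss : √(-c) * √(-c) = -c := Real.mul_self_sqrt hc0.le
  have he := Real.exp_pos (c / 2)
  simp only [eval_add, eval_mul, eval_one, eval_X, eval_ofNat]
  have h5 : Real.exp (c / 2) * ((1 + c) * p.eval c + 2 * c * (derivative p).eval c) =
      -(2 * √(-c)) * ((-1 / (2 * √(-c)) * Real.exp (c / 2) + √(-c) * (Real.exp (c / 2) * (1 / 2))) *
        p.eval c + √(-c) * Real.exp (c / 2) * (derivative p).eval c) := by
    have h6 : 2 * √(-c) * (-1 / (2 * √(-c))) = -1 := by field_simp
    linear_combination (Real.exp (c / 2) * p.eval c) * h6 +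
      (Real.exp (c / 2) * (p.eval c + 2 * (derivative p).eval c)) * hss
  have h7 : ∀ z : ℝ, z = 0 → -(2 * √(-c)) * z = 0 := fun z hz => by rw [hz, mul_zero]
  rw [h7 _ hd] at h5
  exact (mul_eq_zero.1 h5).resolve_left he.ne'

/-- The distinct roots of `p` are negative, and together with `0` they bound as many gaps as there
are roots. Each gap contains a new root, which compensates for the loss of at most one in the
multiplicity at each old root. -/
theorem card_roots_le_of_rolle {p : ℝ[X]} (hp : ∀ x, 0 ≤ x → p.eval x ≠ 0) :
    p.roots.card ≤ ((1 + X) * p + 2 * X * derivative p).roots.card := by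
  set q := (1 + X) * p + 2 * X * derivative p with hq
  have hp0 : p ≠ 0 := by
    rintro rfl
    exact hp 0 le_rfl eval_zero
  have hq0 : q ≠ 0 := by
    intro h
    have := congrArg (eval 0) h
    simp [hq] at this
    exact hp 0 le_rfl this
  have hneg : ∀ x ∈ p.roots.toFinset, x < 0 ∧ p.eval x = 0 := by
    intro x hx
    rw [Multiset.mem_toFinset, mem_roots hp0] at hx
    exact ⟨not_le.1 fun h => hp x h hx, hx⟩
  have h0 : (0 : ℝ) ∉ p.roots.toFinset := fun h => lt_irrefl _ (hneg 0 h).1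
  have hroll : p.roots.toFinset.card ≤ (q.roots.toFinset \ p.roots.toFinset).card := by
    have h := Finset.card_le_sdiff_of_interleaved (s := insert 0 p.roots.toFinset)
      (t := q.roots.toFinset) (by
        intro x hx y hy hxy _
        have hy' : y ≤ 0 ∧ (y = 0 ∨ p.eval y = 0) := by
          rcases Finset.mem_insert.1 hy with rfl | h
          · exact ⟨le_rfl, Or.inl rfl⟩
          · exact ⟨(hneg y h).1.le, Or.inr (hneg y h).2⟩
        have hx' : p.eval x = 0 := by
          rcases Finset.mem_insert.1 hx with rfl | h
          · exact absurd hy'.1 (not_le.2 hxy)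
          · exact (hneg x h).2
        obtain ⟨c, h1, h2, h3⟩ := exists_eval_eq_zero_of_rolle p hxy hy'.1 hx' hy'.2
        exact ⟨c, by rw [Multiset.mem_toFinset, mem_roots hq0]; exact h3, h1, h2⟩)
    rw [Finset.card_insert_of_notMem h0] at h
    exact (Nat.le_of_succ_le_succ h).trans (Finset.card_le_card
      (Finset.sdiff_subset_sdiff le_rfl (Finset.subset_insert _ _)))
  have hmult : ∀ x, p.rootMultiplicity x - 1 ≤ q.rootMultiplicity x := by
    intro x
    rw [le_rootMultiplicity_iff hq0]
    have h1 := p.pow_rootMultiplicity_dvd x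
    exact dvd_add (((pow_dvd_pow _ (Nat.sub_le _ _)).trans h1).mul_left _)
      ((pow_sub_one_dvd_derivative_of_pow_dvd h1).mul_left _)
  calc
    p.roots.card = ∑ x ∈ p.roots.toFinset, p.roots.count x :=
      (Multiset.toFinset_sum_count_eq _).symm
    _ = ∑ x ∈ p.roots.toFinset, (p.roots.count x - 1 + 1) :=
      (Eq.symm <| Finset.sum_congr rfl fun _ hx => tsub_add_cancel_of_le <|
        Nat.succ_le_iff.2 <| Multiset.count_pos.2 <| Multiset.mem_toFinset.1 hx)
    _ = (∑ x ∈ p.roots.toFinset, (p.rootMultiplicity x - 1)) + p.roots.toFinset.card := by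
      simp only [Finset.sum_add_distrib, Finset.card_eq_sum_ones, count_roots]
    _ ≤ (∑ x ∈ p.roots.toFinset, q.rootMultiplicity x) +
          (q.roots.toFinset \ p.roots.toFinset).card :=
      add_le_add (Finset.sum_le_sum fun x _ => hmult x) hroll
    _ ≤ (∑ x ∈ p.roots.toFinset, q.roots.count x) +
          ∑ x ∈ q.roots.toFinset \ p.roots.toFinset, q.roots.count x := by
      simp only [← count_roots, Finset.card_eq_sum_ones]
      gcongr with x hx
      rw [Nat.succ_le_iff, Multiset.count_pos, ← Multiset.mem_toFinset]
      exact (Finset.mem_sdiff.1 hx).1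
    _ = q.roots.card := by
      rw [← Finset.sum_union Finset.disjoint_sdiff, Finset.union_sdiff_self_eq_union,
        ← Multiset.toFinset_sum_count_eq, ← Finset.sum_subset Finset.subset_union_right]
      intro x _ hx₂
      simpa only [Multiset.mem_toFinset, Multiset.count_eq_zero] using hx₂

/-- Dividing out the known roots leaves a factor of degree at most one. This covers the degree
gained in the recurrence, for which Rolle's theorem gives no root. -/
theorem splits_of_natDegree_le_card_roots_succ {q : ℝ[X]} (h : q.natDegree ≤ q.roots.card + 1) :
    q.Splits := by
  obtain ⟨r, hr, hd, -⟩ := exists_prod_multiset_X_sub_C_mul q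
  rw [← hr]
  refine Splits.mul (Splits.multisetProd ?_) (Splits.of_natDegree_le_one (by omega))
  intro f hf
  obtain ⟨a, -, rfl⟩ := Multiset.mem_map.1 hf
  exact Splits.X_sub_C a

theorem splits_of_rolle {p : ℝ[X]} (hs : p.Splits) (hp : ∀ x, 0 ≤ x → p.eval x ≠ 0) :
    ((1 + X) * p + 2 * X * derivative p).Splits := by
  apply splits_of_natDegree_le_card_roots_succ
  have h1 : ((1 + X) * p + 2 * X * derivative p).natDegree ≤ p.natDegree + 1 := by
    refine natDegree_add_le_of_degree_le ?_ ?_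
    · refine natDegree_mul_le.trans ?_
      have : ((1 : ℝ[X]) + X).natDegree ≤ 1 := by compute_degree
      omega
    · refine natDegree_mul_le.trans ?_
      have : ((2 : ℝ[X]) * X).natDegree ≤ 1 := by compute_degree
      have := natDegree_derivative_le p
      omega
  have h2 := card_roots_le_of_rolle hp
  rw [← hs.natDegree_eq_card_roots] at h2
  omega

theorem eval_zero_blockPoly (n : ℕ) : (blockPoly n).eval 0 = 1 := by
  induction n with
  | zero => simp [blockPoly_zero]
  | succ n ih => simp [blockPoly_succ, ih]

theorem eval_blockPoly (n : ℕ) (x : ℝ) :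
    (blockPoly n).eval x = ∑ π : BPartition n, x ^ (blockPairs π).card := by
  simp [blockPoly, eval_finsetSum]

theorem eval_blockPoly_pos (n : ℕ) {x : ℝ} (hx : 0 ≤ x) : 0 < (blockPoly n).eval x := by
  refine lt_of_lt_of_le one_pos ?_
  rw [← eval_zero_blockPoly n, eval_blockPoly, eval_blockPoly]
  exact Finset.sum_le_sum fun π _ => pow_le_pow_left₀ le_rfl hx _

theorem splits_blockPoly (n : ℕ) : (blockPoly n).Splits := by
  induction n with
  | zero => rw [blockPoly_zero]; exact Splits.one
  | succ n ih =>
    rw [blockPoly_succ]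
    exact splits_of_rolle ih fun x hx => (eval_blockPoly_pos n hx).ne'

/-- The number of block pairs is distributed as a sum of independent Bernoulli variables: its
generating polynomial is, up to a constant, a product of generating polynomials of Bernoulli
variables. -/
theorem exists_blockPoly_eq_prod (n : ℕ) : ∃ s : Multiset ℝ, (∀ p ∈ s, 0 ≤ p ∧ p ≤ 1) ∧
    blockPoly n = C ((blockPoly n).eval 1) * (s.map fun p => C (1 - p) + C p * X).prod := by
  have hp0 : blockPoly n ≠ 0 := by
    intro h
    have := eval_zero_blockPoly n
    simp [h] at this
  have hneg : ∀ r ∈ (blockPoly n).roots, r < 0 := by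
    intro r hr
    rw [mem_roots hp0] at hr
    exact not_le.1 fun h => (eval_blockPoly_pos n h).ne' hr
  -- For a root `r < 0`, `(X - r) / (1 - r) = (1 - p) + p X` with `p = 1 / (1 - r)`.
  refine ⟨(blockPoly n).roots.map fun r => (1 - r)⁻¹, ?_, ?_⟩
  · intro p hp
    obtain ⟨r, hr, rfl⟩ := Multiset.mem_map.1 hp
    have := hneg r hr
    exact ⟨inv_nonneg.2 (by linarith), inv_le_one_of_one_le₀ (by linarith)⟩
  · have h1 := (splits_blockPoly n).eval_eq_prod_roots 1
    have h2 := (splits_blockPoly n).eq_prod_roots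
    have h3 : ((blockPoly n).roots.map fun r => (C (1 - r) : ℝ[X])).prod *
        (((blockPoly n).roots.map fun r => (1 - r)⁻¹).map fun p => C (1 - p) + C p * X).prod =
        ((blockPoly n).roots.map fun r => X - C r).prod := by
      rw [Multiset.map_map, ← Multiset.prod_map_mul]
      refine congrArg _ (Multiset.map_congr rfl fun r hr => ?_)
      have h4 : 1 - r ≠ 0 := by linarith [hneg r hr]
      simp only [Function.comp]
      rw [mul_add, ← C_mul, ← mul_assoc, ← C_mul, mul_inv_cancel₀ h4, mul_sub, mul_inv_cancel₀ h4]
      simp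
      ring
    rw [h1, C_mul, mul_assoc]
    conv_lhs => rw [h2, ← h3]
    congr 2
    rw [map_multiset_prod, Multiset.map_map]
    rfl

/-! ### Dobiński's formula -/

/-- The linear functional on polynomials with `X ^ k ↦ 2 ^ k * j (j - 1) ⋯ (j - k + 1)`. -/
noncomputable def umbral (j : ℕ) : ℝ[X] →ₗ[ℝ] ℝ :=
  lsum fun k => LinearMap.mulRight ℝ ((2 : ℝ) ^ k * j.descFactorial k)

theorem umbral_monomial (j k : ℕ) (a : ℝ) :
    umbral j (monomial k a) = a * (2 ^ k * j.descFactorial k) := by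
  simp [umbral, lsum_apply, sum_monomial_index, mul_assoc]

/-- On `X^k` the factor is `(2k + 1) + 2 (j - k) = 2j + 1`: the functional turns the recurrence
operator into multiplication by a scalar. -/
theorem umbral_step (j : ℕ) (p : ℝ[X]) :
    umbral j ((1 + X) * p + 2 * X * derivative p) = (2 * j + 1) * umbral j p := by
  induction p using Polynomial.induction_on' with
  | add p q hp hq =>
    rw [map_add (umbral j) p, mul_add (2 * (j : ℝ) + 1), ← hp, ← hq, ← map_add, derivative_add]
    congr 1
    ring
  | monomial k a =>
    have h1 : (1 + X) * monomial k a + 2 * X * derivative (monomial k a) =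
        monomial (k + 1) a + monomial k ((2 * k + 1) * a) := by
      simp only [← C_mul_X_pow_eq_monomial, derivative_C_mul, derivative_X_pow]
      rcases k with _ | k
      · simp
        ring
      · simp only [C_mul, C_add, map_natCast, map_ofNat, map_one, Nat.cast_add, Nat.cast_one,
          add_tsub_cancel_right]
        ring
    have h2 : (j.descFactorial (k + 1) : ℝ) = (j - k) * j.descFactorial k := by
      rw [Nat.descFactorial_succ]
      rcases le_or_gt k j with h | h
      · push_cast [Nat.cast_sub h]; ring
      · rw [Nat.descFactorial_eq_zero_iff_lt.2 h]; simp
    rw [h1, map_add, umbral_monomial, umbral_monomial, umbral_monomial, h2]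
    ring

theorem umbral_blockPoly (n j : ℕ) : umbral j (blockPoly n) = (2 * j + 1) ^ n := by
  induction n with
  | zero =>
    rw [blockPoly_zero, ← monomial_zero_one, umbral_monomial]
    simp
  | succ n ih => rw [blockPoly_succ, umbral_step, ih, pow_succ']

/-- The `k`-th factorial moment of a Poisson variable of parameter `1 / 2` is `2^(-k)`, so averaging
`umbral j` over it is evaluation at `1`. In the series, the terms `j < k` vanish and the shift `j =
i + k` leaves the exponential series. -/
theorem hasSum_umbral (p : ℝ[X]) :
    HasSum (fun j : ℕ => umbral j p / (2 ^ j * j.factorial)) (p.eval 1 * Real.exp (1 / 2)) := by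
  induction p using Polynomial.induction_on' with
  | add p q hp hq =>
    rw [eval_add, add_mul]
    refine (hp.add hq).congr_fun ?_
    intro j
    rw [map_add, add_div]
  | monomial k a =>
    rw [eval_monomial, one_pow, mul_one]
    have h := NormedSpace.expSeries_div_hasSum_exp (1 / 2 : ℝ)
    rw [← Real.exp_eq_exp_ℝ] at h
    have h2 : HasSum (fun i : ℕ =>
        umbral (i + k) (monomial k a) / (2 ^ (i + k) * (i + k).factorial))
        (a * Real.exp (1 / 2)) := by
      refine (h.mul_left a).congr_fun fun i => ?_
      have h3 : ((i + k).factorial : ℝ) = i.factorial * (i + k).descFactorial k := by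
        have := Nat.factorial_mul_descFactorial (Nat.le_add_left k i)
        rw [Nat.add_sub_cancel] at this
        exact_mod_cast this.symm
      have h4 : ((i + k).descFactorial k : ℝ) ≠ 0 := by
        rw [Nat.cast_ne_zero, Ne, Nat.descFactorial_eq_zero_iff_lt]
        omega
      have h5 : (i.factorial : ℝ) ≠ 0 := by exact_mod_cast i.factorial_ne_zero
      rw [umbral_monomial, h3, pow_add, one_div, inv_pow]
      field_simp
    rw [hasSum_nat_add_iff (f := fun i : ℕ => umbral i (monomial k a) / (2 ^ i * i.factorial))] at h2
    rw [Finset.sum_eq_zero, add_zero] at h2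
    · exact h2
    · intro i hi
      rw [umbral_monomial, Nat.descFactorial_eq_zero_iff_lt.2 (Finset.mem_range.1 hi)]
      simp

/-- The weights of the Dobiński series for the number of `B_n`-partitions. -/
noncomputable def dobinskiWeight (n j : ℕ) : ℝ := (2 * j + 1) ^ n / (2 ^ j * j.factorial)

theorem dobinskiWeight_pos (n j : ℕ) : 0 < dobinskiWeight n j := by
  unfold dobinskiWeight
  positivity

/-- **Dobiński's formula** for `B_n`-partitions. -/
theorem hasSum_dobinskiWeight (n : ℕ) :
    HasSum (dobinskiWeight n) ((blockPoly n).eval 1 * Real.exp (1 / 2)) := by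
  refine (hasSum_umbral (blockPoly n)).congr_fun fun j => ?_
  rw [umbral_blockPoly, dobinskiWeight]

/-! ### The variance through the Dobiński weights -/

/-- The mean number of block pairs. -/
noncomputable def meanBlocks (n : ℕ) : ℝ :=
  (derivative (blockPoly n)).eval 1 / (blockPoly n).eval 1

/-- The variance of the number of block pairs. -/
noncomputable def varBlocks (n : ℕ) : ℝ :=
  (derivative (derivative (blockPoly n))).eval 1 / (blockPoly n).eval 1 + meanBlocks n -
    meanBlocks n ^ 2

/-- Raising `n` by one multiplies the weight by `2j + 1`, so the moments of `2j + 1` are the ratios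
`P (n + 1) 1 / P n 1` and `P (n + 2) 1 / P n 1`. The recurrence at `1` turns these into the moments
of `ξ_n`; in particular the mean is `2 + 2 * meanBlocks n`. -/
theorem hasSum_sq_sub_mul_dobinskiWeight (n : ℕ) :
    HasSum (fun j : ℕ => (2 * j + 1 - (2 + 2 * meanBlocks n)) ^ 2 * dobinskiWeight n j)
      ((4 * varBlocks n + 2) * ((blockPoly n).eval 1 * Real.exp (1 / 2))) := by
  set R := 2 + 2 * meanBlocks n with hR
  have h := ((hasSum_dobinskiWeight (n + 2)).sub ((hasSum_dobinskiWeight (n + 1)).mul_left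
    (2 * R))).add ((hasSum_dobinskiWeight n).mul_left (R ^ 2))
  have hM : (blockPoly n).eval 1 ≠ 0 := (eval_blockPoly_pos n zero_le_one).ne'
  have hd1 : (blockPoly (n + 1)).eval 1 =
      2 * (blockPoly n).eval 1 + 2 * (derivative (blockPoly n)).eval 1 := by
    rw [blockPoly_succ]
    simp only [eval_add, eval_mul, eval_one, eval_X, eval_ofNat]
    ring
  have hd1' : (derivative (blockPoly (n + 1))).eval 1 = (blockPoly n).eval 1 +
      4 * (derivative (blockPoly n)).eval 1 + 2 * (derivative (derivative (blockPoly n))).eval 1 := by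
    rw [blockPoly_succ]
    simp only [derivative_add, derivative_mul, derivative_one, derivative_X, derivative_ofNat,
      eval_add, eval_mul, eval_one, eval_X, eval_ofNat, eval_zero]
    ring
  have hd2 : (blockPoly (n + 2)).eval 1 =
      2 * (blockPoly (n + 1)).eval 1 + 2 * (derivative (blockPoly (n + 1))).eval 1 := by
    rw [blockPoly_succ (n + 1)]
    simp only [eval_add, eval_mul, eval_one, eval_X, eval_ofNat]
    ring
  have h' : (4 * varBlocks n + 2) * ((blockPoly n).eval 1 * Real.exp (1 / 2)) =
      (blockPoly (n + 2)).eval 1 * Real.exp (1 / 2) -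
        2 * R * ((blockPoly (n + 1)).eval 1 * Real.exp (1 / 2)) +
        R ^ 2 * ((blockPoly n).eval 1 * Real.exp (1 / 2)) := by
    rw [hd2, hd1', hd1, hR, varBlocks, meanBlocks]
    field_simp
    ring
  rw [h']
  refine h.congr_fun fun j => ?_
  simp only [dobinskiWeight, pow_add]
  ring

/-- If no weight exceeds a small proportion of the total, the variance is large. -/
theorem sq_le_varBlocks_of_dobinskiWeight_le {n T : ℕ}
    (h : ∀ j, dobinskiWeight n j ≤
      1 / (2 * (2 * T + 1)) * ((blockPoly n).eval 1 * Real.exp (1 / 2))) :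
    (T : ℝ) ^ 2 ≤ 2 * varBlocks n + 1 := by
  set W := (blockPoly n).eval 1 * Real.exp (1 / 2) with hW
  have hWpos : 0 < W := mul_pos (eval_blockPoly_pos n zero_le_one) (Real.exp_pos _)
  set R := 2 + 2 * meanBlocks n with hR
  set ε : ℝ := 1 / (2 * (2 * T + 1)) with hε
  -- Outside the `2T + 1` indices from `a` on, `2j + 1` is at distance at least `2T` from `R`. By
  -- the choice of `ε`, these indices carry at most half of `W`. Truncation of the floor at `0` is
  -- harmless, as then no index lies to the left.
  set a := ⌊(R - 1) / 2 - T⌋₊ with ha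
  have h1 := hasSum_sq_sub_mul_dobinskiWeight n
  rw [← hR, ← hW] at h1
  have h2 : HasSum (fun j : ℕ => if j ∈ Finset.Ico a (a + (2 * T + 1)) then ε * W else 0)
      ((2 * T + 1) * (ε * W)) := by
    have := hasSum_sum_of_ne_finset_zero (L := SummationFilter.unconditional ℕ) (f := fun j : ℕ =>
      if j ∈ Finset.Ico a (a + (2 * T + 1)) then ε * W else 0)
      (s := Finset.Ico a (a + (2 * T + 1))) (fun b hb => if_neg hb)
    rw [Finset.sum_congr rfl (fun x hx => if_pos hx), Finset.sum_const, Nat.card_Ico,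
      Nat.add_sub_cancel_left, nsmul_eq_mul] at this
    push_cast at this
    exact this
  have h3 := ((hasSum_dobinskiWeight n).sub h2).mul_left (4 * (T : ℝ) ^ 2)
  rw [← hW] at h3
  have h4 := hasSum_le (fun j => ?_) h3 h1
  · have h5 : (2 * T + 1) * (ε * W) = W / 2 := by
      rw [hε]
      field_simp
    rw [h5] at h4
    have h6 : (2 * (T : ℝ) ^ 2) * W ≤ (4 * varBlocks n + 2) * W := by linarith
    linarith [le_of_mul_le_mul_right h6 hWpos]
  · have hw := dobinskiWeight_pos n j
    split_ifs with hj
    · have h5 : 4 * (T : ℝ) ^ 2 * (dobinskiWeight n j - ε * W) ≤ 0 :=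
        mul_nonpos_of_nonneg_of_nonpos (by positivity) (by linarith [h j])
      have h6 : 0 ≤ (2 * (j : ℝ) + 1 - R) ^ 2 * dobinskiWeight n j := by positivity
      linarith
    · rw [sub_zero]
      refine mul_le_mul_of_nonneg_right ?_ hw.le
      have h5 : (2 * (T : ℝ)) ^ 2 ≤ (2 * j + 1 - R) ^ 2 := by
        rw [Finset.mem_Ico, not_and_or, not_le, not_lt] at hj
        rcases hj with hj | hj
        · have h7 := (Nat.le_floor_iff' (Nat.succ_ne_zero j)).1 (ha ▸ hj)
          push_cast at h7
          nlinarith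
        · have h7 := Nat.lt_floor_add_one ((R - 1) / 2 - T)
          rw [← ha] at h7
          have h8 : (a : ℝ) + (2 * T + 1) ≤ j := by exact_mod_cast hj
          nlinarith
      linarith

/-! ### Flatness of the weights near their mode -/

theorem dobinskiWeight_succ_le_iff (n m : ℕ) :
    dobinskiWeight n (m + 1) ≤ dobinskiWeight n m ↔
      (2 * (m : ℝ) + 3) ^ n ≤ 2 * (m + 1) * (2 * m + 1) ^ n := by
  have h1 : (0 : ℝ) < 2 ^ m * m.factorial := by positivity
  have h2 : dobinskiWeight n (m + 1) =
      (2 * (m : ℝ) + 3) ^ n / ((2 ^ m * m.factorial) * (2 * (m + 1))) := by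
    rw [dobinskiWeight, Nat.factorial_succ]
    push_cast
    congr 1 <;> ring
  rw [h2, dobinskiWeight, div_le_div_iff₀ (by positivity) h1, mul_comm, mul_comm (2 ^ m * _) (2 * _),
    ← mul_assoc, mul_comm (2 ^ m * _), mul_le_mul_iff_left₀ h1, mul_comm (_ ^ n) (2 * _)]

theorem le_dobinskiWeight_succ_iff (n m : ℕ) :
    dobinskiWeight n m ≤ dobinskiWeight n (m + 1) ↔
      2 * (m + 1) * (2 * m + 1) ^ n ≤ (2 * (m : ℝ) + 3) ^ n := by
  have h1 : (0 : ℝ) < 2 ^ m * m.factorial := by positivity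
  have h2 : dobinskiWeight n (m + 1) =
      (2 * (m : ℝ) + 3) ^ n / ((2 ^ m * m.factorial) * (2 * (m + 1))) := by
    rw [dobinskiWeight, Nat.factorial_succ]
    push_cast
    congr 1 <;> ring
  rw [h2, dobinskiWeight, div_le_div_iff₀ h1 (by positivity), mul_comm (2 ^ m * _) (2 * _),
    ← mul_assoc, mul_le_mul_iff_left₀ h1, mul_comm (_ ^ n) (2 * _)]

theorem exists_dobinskiWeight_mode (n : ℕ) :
    ∃ m, ∀ j, dobinskiWeight n j ≤ dobinskiWeight n m := by
  have h := (hasSum_dobinskiWeight n).summable.tendsto_atTop_zero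
  obtain ⟨N, hN⟩ := ((tendsto_order.1 h).2 _ (dobinskiWeight_pos n 0)).exists_forall_of_atTop
  obtain ⟨m, -, hm⟩ := Finset.exists_max_image (Finset.range (N + 1)) (dobinskiWeight n) ⟨0, by simp⟩
  refine ⟨m, fun j => ?_⟩
  rcases le_or_gt N j with hj | hj
  · exact (hN j hj).le.trans (hm 0 (by simp))
  · exact hm j (by rw [Finset.mem_range]; omega)

/-- The mode of the Dobiński weights exceeds any multiple of `√n`. -/
theorem mul_le_sq_of_mode {n m K : ℕ} (hn : 3 * (338 * K ^ 2 + 1) ≤ n)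
    (h : (2 * (m : ℝ) + 3) ^ n ≤ 2 * (m + 1) * (2 * m + 1) ^ n) : K * n ≤ m ^ 2 := by
  by_contra! hlt
  set k := n / 3 with hk
  have hk1 : 338 * K ^ 2 + 1 ≤ k := by omega
  have hk3 : 3 * k ≤ n := by omega
  have hk5 : n ≤ 5 * k := by omega
  have h1 : (1 + 2 / (2 * (m : ℝ) + 1)) ^ n ≤ 2 * (m + 1) := by
    have : 1 + 2 / (2 * (m : ℝ) + 1) = (2 * m + 3) / (2 * m + 1) := by field_simp; ring
    rw [this, div_pow, div_le_iff₀ (by positivity)]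
    exact h
  have ha : (0 : ℝ) < 2 / (2 * m + 1) := by positivity
  -- Bernoulli's inequality on each of three blocks of `k` factors gives `k^3 = O(m^4)`, so `m` is
  -- at least of order `n^(3/4)`.
  have h2 : (k * (2 / (2 * (m : ℝ) + 1))) ^ 3 ≤ 2 * (m + 1) := by
    calc (k * (2 / (2 * (m : ℝ) + 1))) ^ 3 ≤ ((1 + 2 / (2 * (m : ℝ) + 1)) ^ k) ^ 3 := by
          refine pow_le_pow_left₀ (by positivity) ?_ 3
          linarith [one_add_mul_le_pow (a := 2 / (2 * (m : ℝ) + 1)) (by linarith) k]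
      _ = (1 + 2 / (2 * (m : ℝ) + 1)) ^ (3 * k) := by rw [← pow_mul, Nat.mul_comm k 3]
      _ ≤ (1 + 2 / (2 * (m : ℝ) + 1)) ^ n := pow_le_pow_right₀ (by linarith) hk3
      _ ≤ _ := h1
  have h3 : 8 * (k : ℝ) ^ 3 ≤ 2 * (m + 1) * (2 * m + 1) ^ 3 := by
    rw [mul_pow, div_pow, ← mul_div_assoc, div_le_iff₀ (by positivity)] at h2
    linarith
  have h3' : 8 * k ^ 3 ≤ 2 * (m + 1) * (2 * m + 1) ^ 3 := by exact_mod_cast h3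
  have hkpos : 1 ≤ k := by omega
  rcases Nat.eq_zero_or_pos m with rfl | hm
  · have : k ^ 3 ≥ 1 := Nat.one_le_pow _ _ hkpos
    omega
  -- Here `108 m^4 ≤ 108 * 25 K^2 k^2` yields `8 k ≤ 2700 K^2`, against `k > 338 K^2`.
  have h4 : 2 * (m + 1) * (2 * m + 1) ^ 3 ≤ (4 * m) * (3 * m) ^ 3 :=
    Nat.mul_le_mul (by omega) (Nat.pow_le_pow_left (by omega) 3)
  have h5 : (m ^ 2) ^ 2 ≤ (K * n) ^ 2 := by gcongr
  have h6 : (K * n) ^ 2 ≤ (K * (5 * k)) ^ 2 := by gcongr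
  have h7 : 8 * k ^ 3 ≤ 108 * (25 * K ^ 2 * k ^ 2) := by nlinarith
  have h8 : k ^ 2 * (8 * k) ≤ k ^ 2 * (2700 * K ^ 2) := by nlinarith
  have h9 := le_of_mul_le_mul_left h8 (by positivity)
  omega

/-- Put `a = 2 / (2m + 1)`. That the weight does not drop from `m - 1` to `m` says `2m (1 - a)^n ≤
1`, while the ratio of the weights at `m` and `m + i` is at most `(2 (m + i))^i / (1 + i a)^n`.
Since `(1 + i a) (1 - a)^i ≥ 1 - (i a)^2` and `n (i a)^2 ≤ 1 / 4`, the growth up to `m` nearly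
persists. -/
theorem dobinskiWeight_add_ge {n m i L : ℕ} (hm : 1 ≤ m) (hi : i ≤ L)
    (h1 : 4 * L ^ 2 * n ≤ m ^ 2) (h2 : 4 * L ^ 2 ≤ m)
    (h : 2 * (m : ℝ) * (2 * m - 1) ^ n ≤ (2 * m + 1) ^ n) :
    dobinskiWeight n m ≤ 2 * dobinskiWeight n (m + i) := by
  have hm' : (1 : ℝ) ≤ m := by exact_mod_cast hm
  have h1' : 4 * (L : ℝ) ^ 2 * n ≤ m ^ 2 := by exact_mod_cast h1
  have h2' : 4 * (L : ℝ) ^ 2 ≤ m := by exact_mod_cast h2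
  have hi' : (i : ℝ) ≤ L := by exact_mod_cast hi
  have hi2 : (i : ℝ) ^ 2 ≤ L ^ 2 := by gcongr
  set a : ℝ := 2 / (2 * m + 1) with ha
  have hapos : 0 < a := by positivity
  have ham : a ≤ 1 / m := by
    rw [ha, div_le_div_iff₀ (by positivity) (by positivity)]
    linarith
  have ha1 : a < 1 := by
    rw [ha, div_lt_one (by positivity)]
    linarith
  have ha2 : a ^ 2 ≤ 1 / m ^ 2 := by
    rw [← one_div_pow]
    exact pow_le_pow_left₀ hapos.le ham 2
  have hx : n * (i * a) ^ 2 ≤ 1 / 4 := by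
    calc n * (i * a) ^ 2 = (i : ℝ) ^ 2 * n * a ^ 2 := by ring
      _ ≤ (L : ℝ) ^ 2 * n * (1 / m ^ 2) := by gcongr
      _ ≤ 1 / 4 := by
        rw [mul_one_div, div_le_div_iff₀ (by positivity) (by norm_num)]
        linarith
  have hL1 : (i * a) ^ 2 ≤ 1 := by
    calc (i * a) ^ 2 = (i : ℝ) ^ 2 * a ^ 2 := by ring
      _ ≤ (L : ℝ) ^ 2 * (1 / m ^ 2) := by gcongr
      _ ≤ 1 := by
        rw [mul_one_div, div_le_one (by positivity)]
        nlinarith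
  have hq : (1 - a) ^ n * (2 * m) ≤ 1 := by
    have : 1 - a = (2 * m - 1) / (2 * m + 1) := by rw [ha]; field_simp; ring
    rw [this, div_pow, div_mul_eq_mul_div, div_le_one (by positivity)]
    linarith
  have hpow : 3 / 4 ≤ (1 + i * a) ^ n * ((1 - a) ^ i) ^ n := by
    calc (3 / 4 : ℝ) ≤ 1 + n * (-(i * a) ^ 2) := by linarith
      _ ≤ (1 + -(i * a) ^ 2) ^ n := one_add_mul_le_pow (by linarith) n
      _ ≤ ((1 + i * a) * (1 - a) ^ i) ^ n := by
        refine pow_le_pow_left₀ (by linarith) ?_ n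
        have := one_add_mul_le_pow (a := -a) (by linarith) i
        have h0 : 0 ≤ 1 + i * a := by positivity
        calc 1 + -(i * a) ^ 2 = (1 + i * a) * (1 + i * (-a)) := by ring
          _ ≤ (1 + i * a) * (1 - a) ^ i := mul_le_mul_of_nonneg_left (by simpa [sub_eq_add_neg] using this) h0
      _ = _ := mul_pow _ _ _
  have hmi : 3 / 4 * ((m : ℝ) + i) ^ i ≤ m ^ i := by
    have hpos : (0 : ℝ) < m + i := by positivity
    have h3 : (3 / 4 : ℝ) ≤ (m / (m + i)) ^ i := by
      have h4 : (m : ℝ) / (m + i) = 1 + -(i / (m + i)) := by field_simp; ring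
      have h5 : (i : ℝ) / (m + i) ≤ 1 := by rw [div_le_one hpos]; linarith
      have h6 : (i : ℝ) * (i / (m + i)) ≤ 1 / 4 := by
        rw [← mul_div_assoc, div_le_div_iff₀ hpos (by norm_num)]
        have : (0 : ℝ) ≤ i := Nat.cast_nonneg i
        nlinarith
      rw [h4]
      have := one_add_mul_le_pow (a := -((i : ℝ) / (m + i))) (by linarith) i
      linarith
    rw [div_pow, le_div_iff₀ (by positivity)] at h3
    exact h3
  -- Each of `hpow` and `hmi` costs a factor `4 / 3`, and `16 / 9 ≤ 2`.
  have hmain : (2 * ((m : ℝ) + i)) ^ i ≤ 2 * (1 + i * a) ^ n := by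
    have h3 : ((1 - a) ^ i) ^ n * (2 * m) ^ i ≤ 1 := by
      rw [← pow_mul, mul_comm i n, pow_mul, ← mul_pow]
      exact pow_le_one₀ (mul_nonneg (pow_nonneg (by linarith) _) (by positivity)) hq
    have h4 : 3 / 4 * (2 * (m : ℝ)) ^ i ≤ (1 + i * a) ^ n := by
      calc 3 / 4 * (2 * (m : ℝ)) ^ i
          ≤ (1 + i * a) ^ n * ((1 - a) ^ i) ^ n * (2 * m) ^ i := by gcongr
        _ = (1 + i * a) ^ n * (((1 - a) ^ i) ^ n * (2 * m) ^ i) := by ring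
        _ ≤ (1 + i * a) ^ n * 1 := by gcongr
        _ = _ := mul_one _
    have h5 : 3 / 4 * (2 * ((m : ℝ) + i)) ^ i ≤ (2 * m) ^ i := by
      rw [mul_pow, mul_pow]
      nlinarith [pow_pos (two_pos : (0 : ℝ) < 2) i]
    nlinarith [pow_pos (by positivity : (0 : ℝ) < 2 * (m + i)) i]
  have hfac : ((m + i).factorial : ℝ) ≤ m.factorial * ((m : ℝ) + i) ^ i := by
    have := Nat.mul_le_mul_left m.factorial (Nat.ascFactorial_le_pow_add m i)
    rw [Nat.factorial_mul_ascFactorial] at this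
    exact_mod_cast this
  have hnum : (2 * ((m + i : ℕ) : ℝ) + 1) ^ n = (2 * m + 1) ^ n * (1 + i * a) ^ n := by
    rw [← mul_pow]
    congr 1
    rw [ha]
    push_cast
    field_simp
    ring
  rw [dobinskiWeight, dobinskiWeight, hnum, ← mul_div_assoc,
    div_le_div_iff₀ (by positivity) (by positivity), pow_add]
  calc (2 * (m : ℝ) + 1) ^ n * (2 ^ m * 2 ^ i * (m + i).factorial)
      ≤ (2 * (m : ℝ) + 1) ^ n * (2 ^ m * 2 ^ i * (m.factorial * ((m : ℝ) + i) ^ i)) := by gcongr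
    _ = ((2 * (m : ℝ) + 1) ^ n * (2 ^ m * m.factorial)) * (2 * ((m : ℝ) + i)) ^ i := by
      rw [mul_pow]; ring
    _ ≤ ((2 * (m : ℝ) + 1) ^ n * (2 ^ m * m.factorial)) * (2 * (1 + i * a) ^ n) := by gcongr
    _ = _ := by ring

/-- The `L` indices from the mode on each carry at least half of the largest weight, and their sum
is at most the total. -/
theorem eventually_dobinskiWeight_le {L : ℕ} (hL : 1 ≤ L) : ∀ᶠ n in atTop, ∀ j,
    (L : ℝ) * dobinskiWeight n j ≤ 2 * ((blockPoly n).eval 1 * Real.exp (1 / 2)) := by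
  filter_upwards [eventually_ge_atTop (3 * (338 * (4 * L ^ 2) ^ 2 + 1))] with n hn j
  obtain ⟨m, hm⟩ := exists_dobinskiWeight_mode n
  have hL2 : 1 ≤ 4 * L ^ 2 := by nlinarith
  have h1 := mul_le_sq_of_mode hn ((dobinskiWeight_succ_le_iff n m).1 (hm _))
  have hKn : 4 * L ^ 2 ≤ n := by nlinarith
  have h2 : 4 * L ^ 2 ≤ m := by
    by_contra! hlt
    nlinarith
  obtain ⟨k, rfl⟩ : ∃ k, m = k + 1 := ⟨m - 1, by omega⟩
  have h3 := (le_dobinskiWeight_succ_iff n k).1 (hm k)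
  have h4 : ∀ i ∈ Finset.range L,
      dobinskiWeight n (k + 1) ≤ 2 * dobinskiWeight n (k + 1 + i) := by
    intro i hi
    refine dobinskiWeight_add_ge (L := L) (by omega) (Finset.mem_range.1 hi).le h1 h2 ?_
    push_cast
    convert h3 using 2 <;> ring
  have h5 := Finset.sum_le_sum h4
  rw [Finset.sum_const, Finset.card_range, nsmul_eq_mul, ← Finset.mul_sum] at h5
  have h6 : ∑ i ∈ Finset.range L, dobinskiWeight n (k + 1 + i) ≤
      (blockPoly n).eval 1 * Real.exp (1 / 2) := by
    rw [← Finset.sum_image (f := dobinskiWeight n) (g := fun i => k + 1 + i)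
      (fun _ _ _ _ h => Nat.add_left_cancel h)]
    exact sum_le_hasSum _ (fun _ _ => (dobinskiWeight_pos n _).le) (hasSum_dobinskiWeight n)
  have h7 : (L : ℝ) * dobinskiWeight n j ≤ L * dobinskiWeight n (k + 1) := by
    gcongr
    exact hm j
  linarith

theorem tendsto_varBlocks : Tendsto varBlocks atTop atTop := by
  rw [tendsto_atTop]
  intro b
  obtain ⟨T, hT⟩ := exists_nat_ge (2 * |b| + 2)
  -- With this `L`, the bound `2 / L` is exactly the proportion `1 / (2 (2T + 1))`.
  filter_upwards [eventually_dobinskiWeight_le (L := 4 * (2 * T + 1)) (by omega)] with n hn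
  have h := sq_le_varBlocks_of_dobinskiWeight_le (n := n) (T := T) fun j => by
    have := hn j
    push_cast at this
    rw [one_div_mul_eq_div, le_div_iff₀ (by positivity)]
    linarith
  have hb := le_abs_self b
  nlinarith [abs_nonneg b]

/-! ### Characteristic functions of Bernoulli sums -/

theorem norm_exp_mul_I_sub_le {x : ℝ} (hx : |x| ≤ 1) :
    ‖Complex.exp (x * Complex.I) - (1 + x * Complex.I - x ^ 2 / 2)‖ ≤ |x| ^ 3 := by
  have hn : ‖(x : ℂ) * Complex.I‖ = |x| := by simp
  have h := Complex.exp_bound (x := x * Complex.I) (by rwa [hn]) (n := 3) (by norm_num)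
  rw [hn] at h
  have h1 : ∑ m ∈ Finset.range 3, ((x : ℂ) * Complex.I) ^ m / (m.factorial : ℂ) =
      1 + x * Complex.I - x ^ 2 / 2 := by
    simp [Finset.sum_range_succ, mul_pow, Nat.factorial]
    ring
  rw [h1] at h
  refine h.trans (mul_le_of_le_one_right (by positivity) ?_)
  norm_num [Nat.factorial]

/-- The characteristic function of a centred Bernoulli variable. -/
noncomputable def bernoulliChar (θ p : ℝ) : ℂ :=
  (1 - p + p * Complex.exp (θ * Complex.I)) * Complex.exp (-(θ * p) * Complex.I)

theorem bernoulliChar_eq (θ p : ℝ) : bernoulliChar θ p =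
    (1 - p) * Complex.exp ((-(θ * p) : ℝ) * Complex.I) +
      p * Complex.exp ((θ * (1 - p) : ℝ) * Complex.I) := by
  rw [bernoulliChar, add_mul, mul_assoc (p : ℂ), ← Complex.exp_add]
  push_cast
  ring_nf

theorem norm_bernoulliChar_le (θ : ℝ) {p : ℝ} (h0 : 0 ≤ p) (h1 : p ≤ 1) :
    ‖bernoulliChar θ p‖ ≤ 1 := by
  rw [bernoulliChar_eq]
  refine (norm_add_le _ _).trans ?_
  rw [norm_mul, norm_mul, Complex.norm_exp_ofReal_mul_I, Complex.norm_exp_ofReal_mul_I,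
    ← Complex.ofReal_one, ← Complex.ofReal_sub, Complex.norm_of_nonneg h0,
    Complex.norm_of_nonneg (sub_nonneg.2 h1)]
  linarith

/-- Centring cancels the linear terms, and the quadratic ones agree. The error keeps the factor `p
(1 - p)`, so that the errors of many factors add up to a multiple of the total variance. -/
theorem norm_bernoulliChar_sub_le {θ p : ℝ} (hθ : |θ| ≤ 1) (h0 : 0 ≤ p) (h1 : p ≤ 1) :
    ‖bernoulliChar θ p - Complex.exp ((-(θ ^ 2 * (p * (1 - p)) / 2) : ℝ))‖ ≤
      2 * |θ| ^ 3 * (p * (1 - p)) := by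
  have hq : 0 ≤ 1 - p := sub_nonneg.2 h1
  have hθ0 := abs_nonneg θ
  have e1 : |-(θ * p)| = |θ| * p := by rw [abs_neg, abs_mul, abs_of_nonneg h0]
  have e2 : |θ * (1 - p)| = |θ| * (1 - p) := by rw [abs_mul, abs_of_nonneg hq]
  have a1 := norm_exp_mul_I_sub_le (x := -(θ * p)) (by rw [e1]; nlinarith)
  have a2 := norm_exp_mul_I_sub_le (x := θ * (1 - p)) (by rw [e2]; nlinarith)
  rw [e1] at a1
  rw [e2] at a2
  set u := θ ^ 2 * (p * (1 - p)) / 2 with hu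
  have hpq : p * (1 - p) ≤ 1 / 4 := by nlinarith [sq_nonneg (p - 1 / 2)]
  have hpq0 : 0 ≤ p * (1 - p) := mul_nonneg h0 hq
  have hθ2 : θ ^ 2 ≤ |θ| := by rw [← sq_abs]; nlinarith
  have hθ2' : θ ^ 2 = |θ| ^ 2 := (sq_abs θ).symm
  have hu0 : 0 ≤ u := by positivity
  have hu1 : u ≤ 1 := by rw [hu]; nlinarith
  have a3 := Real.abs_exp_sub_one_sub_id_le (x := -u) (by rw [abs_neg, abs_of_nonneg hu0]; exact hu1)
  have a3' : ‖Complex.exp ((-u : ℝ)) - (1 - u)‖ ≤ |θ| ^ 3 * (p * (1 - p)) := by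
    have : Complex.exp ((-u : ℝ)) - (1 - u) = ((Real.exp (-u) - 1 - -u : ℝ) : ℂ) := by
      push_cast; ring
    rw [this, Complex.norm_real, Real.norm_eq_abs]
    refine a3.trans ?_
    have h3 : (-u) ^ 2 = |θ| ^ 3 * (p * (1 - p)) * (|θ| * (p * (1 - p)) / 4) := by
      rw [hu, hθ2']; ring
    rw [h3]
    refine mul_le_of_le_one_right (by positivity) ?_
    nlinarith
  have key : bernoulliChar θ p - Complex.exp ((-u : ℝ)) =
      ((1 - p : ℝ) : ℂ) * (Complex.exp ((-(θ * p) : ℝ) * Complex.I) -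
        (1 + (-(θ * p) : ℝ) * Complex.I - (-(θ * p) : ℝ) ^ 2 / 2)) +
      p * (Complex.exp ((θ * (1 - p) : ℝ) * Complex.I) -
        (1 + (θ * (1 - p) : ℝ) * Complex.I - (θ * (1 - p) : ℝ) ^ 2 / 2)) -
      (Complex.exp ((-u : ℝ)) - (1 - u)) := by
    rw [bernoulliChar_eq, hu]
    push_cast
    ring
  rw [key]
  refine (norm_sub_le _ _).trans ?_
  have h4 := norm_add_le (((1 - p : ℝ) : ℂ) * (Complex.exp ((-(θ * p) : ℝ) * Complex.I) -
        (1 + (-(θ * p) : ℝ) * Complex.I - (-(θ * p) : ℝ) ^ 2 / 2)))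
      (p * (Complex.exp ((θ * (1 - p) : ℝ) * Complex.I) -
        (1 + (θ * (1 - p) : ℝ) * Complex.I - (θ * (1 - p) : ℝ) ^ 2 / 2)))
  rw [norm_mul, norm_mul, Complex.norm_of_nonneg h0, Complex.norm_of_nonneg hq] at h4
  have h5 : (1 - p) * (|θ| * p) ^ 3 + p * (|θ| * (1 - p)) ^ 3 ≤ |θ| ^ 3 * (p * (1 - p)) := by
    have : (1 - p) * (|θ| * p) ^ 3 + p * (|θ| * (1 - p)) ^ 3 =
      |θ| ^ 3 * (p * (1 - p)) * (p ^ 2 + (1 - p) ^ 2) := by ring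
    rw [this]
    exact mul_le_of_le_one_right (by positivity) (by nlinarith)
  have h6 := mul_le_mul_of_nonneg_left a1 hq
  have h7 := mul_le_mul_of_nonneg_left a2 h0
  linarith

/-- All factors have norm at most one, so replacing them one by one adds the individual errors. The
first two claims are needed to carry the induction. -/
theorem norm_prod_bernoulliChar_sub_le {θ : ℝ} (hθ : |θ| ≤ 1) (s : Multiset ℝ)
    (hs : ∀ p ∈ s, 0 ≤ p ∧ p ≤ 1) :
    ‖(s.map (bernoulliChar θ)).prod‖ ≤ 1 ∧ 0 ≤ (s.map fun p => p * (1 - p)).sum ∧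
    ‖(s.map (bernoulliChar θ)).prod -
        Complex.exp ((-(θ ^ 2 * (s.map fun p => p * (1 - p)).sum / 2) : ℝ))‖ ≤
      2 * |θ| ^ 3 * (s.map fun p => p * (1 - p)).sum := by
  induction s using Multiset.induction with
  | empty => simp
  | cons p s ih =>
    obtain ⟨i1, i2, i3⟩ := ih fun q hq => hs q (Multiset.mem_cons_of_mem hq)
    obtain ⟨h0, h1⟩ := hs p (Multiset.mem_cons_self p s)
    simp only [Multiset.map_cons, Multiset.prod_cons, Multiset.sum_cons]
    set A := (s.map (bernoulliChar θ)).prod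
    set v := (s.map fun p => p * (1 - p)).sum
    have hb := norm_bernoulliChar_le θ h0 h1
    have hd := norm_bernoulliChar_sub_le hθ h0 h1
    have hpq0 : 0 ≤ p * (1 - p) := mul_nonneg h0 (sub_nonneg.2 h1)
    refine ⟨?_, by positivity, ?_⟩
    · rw [norm_mul]
      exact mul_le_one₀ hb (norm_nonneg _) i1
    · have e : ((-(θ ^ 2 * (p * (1 - p) + v) / 2) : ℝ) : ℂ) =
          (-(θ ^ 2 * (p * (1 - p)) / 2) : ℝ) + (-(θ ^ 2 * v / 2) : ℝ) := by push_cast; ring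
      rw [e, Complex.exp_add]
      set B := Complex.exp ((-(θ ^ 2 * (p * (1 - p)) / 2) : ℝ))
      set D := Complex.exp ((-(θ ^ 2 * v / 2) : ℝ)) with hD
      have hDn : ‖D‖ ≤ 1 := by
        rw [hD, ← Complex.ofReal_exp, Complex.norm_real, Real.norm_eq_abs, Real.abs_exp,
          Real.exp_le_one_iff]
        have : 0 ≤ θ ^ 2 * v := by positivity
        linarith
      have e2 : bernoulliChar θ p * A - B * D =
          bernoulliChar θ p * (A - D) + (bernoulliChar θ p - B) * D := by ring
      rw [e2]
      refine (norm_add_le _ _).trans ?_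
      rw [norm_mul, norm_mul]
      have h5 := mul_le_of_le_one_left (norm_nonneg (A - D)) hb
      have h6 := mul_le_of_le_one_right (norm_nonneg (bernoulliChar θ p - B)) hDn
      linarith

theorem prod_bernoulliChar (θ : ℝ) (s : Multiset ℝ) :
    (s.map (bernoulliChar θ)).prod =
      aeval (Complex.exp (θ * Complex.I)) (s.map fun p => (C (1 - p) + C p * X : ℝ[X])).prod *
        Complex.exp (-(θ * s.sum) * Complex.I) := by
  induction s using Multiset.induction with
  | empty => simp
  | cons p s ih =>
    simp only [Multiset.map_cons, Multiset.prod_cons, Multiset.sum_cons, ih, bernoulliChar,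
      map_mul, map_add, aeval_C, aeval_X]
    have : -((θ : ℂ) * ((p + s.sum : ℝ) : ℂ)) * Complex.I =
        -(θ * p) * Complex.I + -(θ * s.sum) * Complex.I := by push_cast; ring
    rw [this, Complex.exp_add]
    simp
    ring

theorem eval_derivatives_bernoulliProd (s : Multiset ℝ) :
    ((s.map fun p => (C (1 - p) + C p * X : ℝ[X])).prod).eval 1 = 1 ∧
    (derivative (s.map fun p => (C (1 - p) + C p * X : ℝ[X])).prod).eval 1 = s.sum ∧
    (derivative (derivative (s.map fun p => (C (1 - p) + C p * X : ℝ[X])).prod)).eval 1 =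
      (s.map fun p => p * (1 - p)).sum - s.sum + s.sum ^ 2 := by
  induction s using Multiset.induction with
  | empty => simp
  | cons p s ih =>
    obtain ⟨i1, i2, i3⟩ := ih
    simp only [Multiset.map_cons, Multiset.prod_cons, Multiset.sum_cons, derivative_mul,
      derivative_add, derivative_C, derivative_X, eval_add, eval_mul, eval_C, eval_X, eval_zero,
      eval_one, i1, i2, i3]
    refine ⟨?_, ?_, ?_⟩ <;> (simp; try ring)

/-- The characteristic function of the normalised number of block pairs is close to the Gaussian
one. -/
theorem norm_blockPoly_sub_le {n : ℕ} {θ : ℝ} (hθ : |θ| ≤ 1) :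
    ‖aeval (Complex.exp (θ * Complex.I)) (blockPoly n) / ((blockPoly n).eval 1 : ℝ) *
        Complex.exp (-(θ * meanBlocks n) * Complex.I) -
        Complex.exp ((-(θ ^ 2 * varBlocks n / 2) : ℝ))‖ ≤ 2 * |θ| ^ 3 * varBlocks n := by
  obtain ⟨s, hs, h⟩ := exists_blockPoly_eq_prod n
  have hM : (blockPoly n).eval 1 ≠ 0 := (eval_blockPoly_pos n zero_le_one).ne'
  obtain ⟨-, i2, i3⟩ := eval_derivatives_bernoulliProd s
  have hmean : meanBlocks n = s.sum := by
    rw [meanBlocks, div_eq_iff hM]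
    conv_lhs => rw [h]
    rw [derivative_C_mul, eval_mul, eval_C, i2, mul_comm]
  have hvar : varBlocks n = (s.map fun p => p * (1 - p)).sum := by
    have : (derivative (derivative (blockPoly n))).eval 1 / (blockPoly n).eval 1 =
        (s.map fun p => p * (1 - p)).sum - s.sum + s.sum ^ 2 := by
      rw [div_eq_iff hM]
      conv_lhs => rw [h]
      rw [derivative_C_mul, derivative_C_mul, eval_mul, eval_C, i3, mul_comm]
    rw [varBlocks, this, hmean]
    ring
  have hchar : aeval (Complex.exp (θ * Complex.I)) (blockPoly n) / ((blockPoly n).eval 1 : ℝ) *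
      Complex.exp (-(θ * meanBlocks n) * Complex.I) = (s.map (bernoulliChar θ)).prod := by
    have hMC : (((blockPoly n).eval 1 : ℝ) : ℂ) ≠ 0 := Complex.ofReal_ne_zero.2 hM
    rw [prod_bernoulliChar, hmean]
    congr 1
    rw [div_eq_iff hMC]
    conv_lhs => rw [h]
    rw [map_mul, aeval_C, mul_comm]
    rfl
  rw [hchar, hvar]
  exact (norm_prod_bernoulliChar_sub_le hθ s hs).2.2

/-! ### Moments and characteristic function of `ξ_n` -/

theorem integral_unif {E : Type*} [NormedAddCommGroup E] [NormedSpace ℝ E] [CompleteSpace E]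
    (n : ℕ) (g : BPartition n → E) :
    ∫ π, g π ∂(unif n) = ((blockPoly n).eval 1)⁻¹ • ∑ π, g π := by
  have hc : (blockPoly n).eval 1 = Fintype.card (BPartition n) := by simp [eval_blockPoly]
  have h : ∀ π : BPartition n, (unif n).real {π} = (Fintype.card (BPartition n) : ℝ)⁻¹ := by
    intro π
    rw [measureReal_def, unif, uniformOn_univ, Measure.count_singleton]
    simp
  rw [integral_fintype (Integrable.of_finite), Finset.smul_sum, hc]
  exact Finset.sum_congr rfl fun π _ => by rw [h]

theorem integral_xi (n : ℕ) : ∫ π, xi n π ∂(unif n) = meanBlocks n := by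
  rw [integral_unif, meanBlocks, smul_eq_mul, div_eq_inv_mul]
  congr 1
  simp [blockPoly, xi, eval_finsetSum, derivative_X_pow]

theorem variance_xi (n : ℕ) : variance (xi n) (unif n) = varBlocks n := by
  have hm : MemLp (xi n) 2 (unif n) := MemLp.of_discrete
  rw [variance_eq_sub hm, integral_xi, varBlocks, meanBlocks, integral_unif]
  congr 1
  rw [smul_eq_mul, ← add_div, div_eq_inv_mul]
  congr 1
  simp only [blockPoly, derivative_sum, eval_finsetSum, ← Finset.sum_add_distrib]
  refine Finset.sum_congr rfl fun π _ => ?_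
  simp only [xi, Pi.pow_apply, derivative_X_pow]
  rcases (blockPairs π).card with _ | k
  · simp
  · simp [derivative_X_pow]
    ring

theorem charFun_xi (n : ℕ) (t : ℝ) :
    charFun ((unif n).map fun π => (xi n π - ∫ ρ, xi n ρ ∂(unif n)) /
        Real.sqrt (variance (xi n) (unif n))) t =
      aeval (Complex.exp ((t / √(varBlocks n) : ℝ) * Complex.I)) (blockPoly n) /
        ((blockPoly n).eval 1 : ℝ) *
        Complex.exp (-((t / √(varBlocks n) : ℝ) * meanBlocks n) * Complex.I) := by
  rw [charFun_apply_real, integral_map (Measurable.of_discrete).aemeasurable (by fun_prop),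
    integral_unif, integral_xi, variance_xi, blockPoly, map_sum, ← blockPoly, div_eq_inv_mul,
    mul_assoc, Finset.sum_mul, Complex.real_smul, Complex.ofReal_inv]
  congr 1
  refine Finset.sum_congr rfl fun π _ => ?_
  rw [map_pow, aeval_X, ← Complex.exp_nat_mul, ← Complex.exp_add, xi]
  congr 1
  push_cast
  ring

/-- At `θ = t / √V` the error `2 |θ|^3 V` equals `2 |t|^3 / √V`, which vanishes as `V` grows. -/
theorem tendsto_charFun_xi (t : ℝ) :
    Tendsto (fun n => charFun ((unif n).map fun π => (xi n π - ∫ ρ, xi n ρ ∂(unif n)) /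
        Real.sqrt (variance (xi n) (unif n))) t) atTop (nhds (charFun (gaussianReal 0 1) t)) := by
  have hs : Tendsto (fun n => √(varBlocks n)) atTop atTop :=
    Real.tendsto_sqrt_atTop.comp tendsto_varBlocks
  have hlim : Tendsto (fun n => 2 * |t| ^ 3 / √(varBlocks n)) atTop (nhds 0) :=
    hs.const_div_atTop _
  rw [tendsto_iff_norm_sub_tendsto_zero]
  refine squeeze_zero' (Eventually.of_forall fun _ => norm_nonneg _) ?_ hlim
  filter_upwards [hs.eventually_ge_atTop |t|, hs.eventually_gt_atTop 0] with n h1 h2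
  have hv : √(varBlocks n) ^ 2 = varBlocks n := Real.sq_sqrt (Real.sqrt_pos.1 h2).le
  have hθ : |t / √(varBlocks n)| ≤ 1 := by
    rw [abs_div, abs_of_pos h2, div_le_one h2]
    exact h1
  have h := norm_blockPoly_sub_le (n := n) hθ
  have e1 : (t / √(varBlocks n)) ^ 2 * varBlocks n = t ^ 2 := by
    rw [div_pow, hv, div_mul_cancel₀ _ (by rw [← hv]; positivity)]
  have e2 : 2 * |t / √(varBlocks n)| ^ 3 * varBlocks n = 2 * |t| ^ 3 / √(varBlocks n) := by
    rw [abs_div, abs_of_pos h2, ← hv, Real.sqrt_sq h2.le]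
    field_simp
  have e3 : charFun (gaussianReal 0 1) t = Complex.exp ((-(t ^ 2 / 2) : ℝ)) := by
    rw [charFun_gaussianReal]
    congr 1
    push_cast
    simp
  rw [e1, e2] at h
  rw [charFun_xi, e3]
  exact h

end TypeB

theorem mainTheorem1 :
    TendstoInDistribution
      (fun (n : ℕ) (π : TypeB.BPartition n) =>
        (TypeB.xi n π - ∫ ρ, TypeB.xi n ρ ∂(TypeB.unif n)) /
          Real.sqrt (variance (TypeB.xi n) (TypeB.unif n)))
      atTop (id : ℝ → ℝ) TypeB.unif (gaussianReal 0 1) where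
  forall_aemeasurable _ := Measurable.of_discrete.aemeasurable
  aemeasurable_limit := aemeasurable_id
  tendsto := by
    -- Lévy's continuity theorem.
    refine ProbabilityMeasure.tendsto_iff_tendsto_charFun.2 fun t => ?_
    simpa using! TypeB.tendsto_charFun_xi t
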